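/- **Model.** Let $n\ge 1$ and $k\ge 2$ be integers and $\delta>0$. A hidden labeling $g:[n]\to\{0,\dots,k-1\}$ is observed through noisy pairwise differences: for each pair $i<j$ in $[n]$, a query to $\{i,j\}$ returns $\tilde f(i,j)=(g(i)-g(j)+\eta_{ij}) \bmod k$, where the noises $\eta_{ij}$ are i.i.d. with $\Pr[\eta_{ij}=0]=\frac1k+\delta$ and $\Pr[\eta_{ij}=a]=\frac1k-\frac{\delta}{k-1}$ for each $a\in\{1,\dots,k-1\}$; each pair is queried at most once. A (possibly randomized) non-adaptive query algorithm uses its own random coins, independent of the noise, to choose a set of pairs, receives the answers on all of them, and then outputs a labeling computed from the coins and the answers. It makes at most $t$ queries if, for every outcome of the coins, the chosen set has at most $t$ pairs. Its success probability is $\min_{g}\Pr[\text{the output equals } g \text{ up to adding a constant to all labels modulo } k]$, the probability being over the coins and the noise. **Theorem (lower bound).** There is an absolute constant $c>0$ such that the following holds for all sequences of integers $k=k(n)\ge 2$ with $k\le n^{o(1)}$, reals $\delta=\delta(n)$ and integers $t=t(n)\ge 0$, where asymptotics are for $n\to\infty$ and the hypotheses on $k$ and $\delta$ are only needed for all large $n$.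 1. If $\frac{1}{n^{1/4}}\le\delta\le\frac{1}{2k}$ and $t=o\!\left(\frac{n\log n}{\delta^2k}\right)$, then for all sufficiently large $n$ every (possibly randomized) non-adaptive query algorithm making at most $t$ queries has success probability at most $\exp(-n^{c})$. 2. If $\frac{1}{2k}\le\delta\le\frac14$ and $t=o\!\left(\frac{n\log n}{\delta}\right)$, then for all sufficiently large $n$ every (possibly randomized) non-adaptive query algorithm making at most $t$ queries has success probability at most $\exp(-n^{c})$. -/

import Mathlib

open Filter Topology Asymptotics MeasureTheory

universe u

namespace JointAlignment

/-- The unordered pairs `{i, j}` of distinct items of `[n]`, each written with `i < j`. -/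
abbrev ItemPair (n : ℕ) : Type := {p : Fin n × Fin n // p.1 < p.2}

/-- The probability that the noise on a pair equals `i`. -/
noncomputable def noiseProb (k : ℕ) (δ : ℝ) (i : Fin k) : ℝ :=
  if (i : ℕ) = 0 then 1 / (k : ℝ) + δ else 1 / (k : ℝ) - δ / ((k : ℝ) - 1)

/-- The law of the noise on one pair (a probability measure if `2 ≤ k` and
`0 ≤ δ ≤ 1 - 1 / k`). -/
noncomputable def noiseLaw (k : ℕ) (δ : ℝ) : Measure (Fin k) :=
  ∑ i : Fin k, ENNReal.ofReal (noiseProb k δ i) • Measure.dirac i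

/-- The joint law of the noise on all pairs: i.i.d. with law `noiseLaw k δ`. -/
noncomputable def jointNoiseLaw (n k : ℕ) (δ : ℝ) : Measure (ItemPair n → Fin k) :=
  Measure.pi fun _ => noiseLaw k δ

/-- The measurement on the pair `(i, j)`: `(g i - g j + η i j) mod k`
(arithmetic in `Fin k` is modulo `k`). -/
def measurement {n k : ℕ} (g : Fin n → Fin k) (η : ItemPair n → Fin k) (p : ItemPair n) : Fin k :=
  g p.1.1 - g p.1.2 + η p

/-- `h` equals `g` up to a cyclic shift of the labels. -/
def EqUpToShift {n k : ℕ} (h g : Fin n → Fin k) : Prop :=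
  ∃ a : Fin k, ∀ v, h v = g v + a

/-- A deterministic non-adaptive query algorithm: a set of pairs to query, fixed in advance, and
a labeling computed from the answers to these queries. -/
structure DetAlg (n k : ℕ) : Type where
  queries : Finset (ItemPair n)
  output : (queries → Fin k) → (Fin n → Fin k)

/-- The deterministic algorithms form a finite set, taken with its discrete `σ`-algebra. -/
instance (n k : ℕ) : MeasurableSpace (DetAlg n k) := ⊤

/-- The labeling returned when the hidden labeling is `g` and the noise is `η`. -/
def DetAlg.result {n k : ℕ} (D : DetAlg n k) (g : Fin n → Fin k) (η : ItemPair n → Fin k) :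
    Fin n → Fin k :=
  D.output fun p => measurement g η p.1

/-- A randomized non-adaptive query algorithm: the coins, drawn from an arbitrary probability
space, select the queries and the way in which the answers are processed. -/
structure RandAlg (n k : ℕ) : Type (u + 1) where
  Coins : Type u
  [measurableSpaceCoins : MeasurableSpace Coins]
  coinLaw : Measure Coins
  [isProbabilityMeasure_coinLaw : IsProbabilityMeasure coinLaw]
  run : Coins → DetAlg n k
  measurable_run : Measurable run

attribute [instance] RandAlg.measurableSpaceCoins RandAlg.isProbabilityMeasure_coinLaw

/-- The algorithm makes at most `t` queries, whatever its coins. -/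
def RandAlg.MakesAtMost {n k : ℕ} (A : RandAlg.{u} n k) (t : ℕ) : Prop :=
  ∀ ω, (A.run ω).queries.card ≤ t

/-- The probability, over the coins and the independent noise, that the hidden labeling `g` is
recovered up to a cyclic shift. -/
noncomputable def RandAlg.successProbAt {n k : ℕ} (A : RandAlg.{u} n k) (δ : ℝ)
    (g : Fin n → Fin k) : ℝ :=
  (A.coinLaw.prod (jointNoiseLaw n k δ)).real
    {x | EqUpToShift ((A.run x.1).result g x.2) g}

/-- The success probability: the largest `ε` such that every hidden labeling is recovered up to a
cyclic shift with probability at least `ε`. -/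
noncomputable def RandAlg.successProb {n k : ℕ} (A : RandAlg.{u} n k) (δ : ℝ) : ℝ :=
  ⨅ g : Fin n → Fin k, A.successProbAt δ g

/-- `k ≤ n ^ o(1)`. -/
def SubpolynomiallyBounded (k : ℕ → ℕ) : Prop :=
  ∃ e : ℕ → ℝ, Tendsto e atTop (𝓝 0) ∧ ∀ᶠ n : ℕ in atTop, (k n : ℝ) ≤ (n : ℝ) ^ e n

end JointAlignment

/-!
The success probability is at most the average, over a uniformly random labeling, of the probability
of recovery, and it suffices to bound this average for a deterministic algorithm with a fixed set of
`t` queries. View the queries as the edges of a graph on the items. At least half of the items have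
degree at most `Δ = 4t/n`, and among them there is an independent set `S` of size at least
`n / (2(Δ + 1))` (`exists_large_isIndep`).

Even when all labels outside `S` are revealed, the label of each item of `S` has to be guessed
from the at most `Δ` answers on its own edges, and these guesses are independent of one another.
A single guess errs with probability at least `(1 - h)^(2Δ) / (2k)`, where `h` is the squared
Hellinger distance between two possible laws of one answer: the Bhattacharyya coefficient of two
fixed labels is multiplicative over the answers, and it bounds the overlap of the two likelihoods
from below (`sum_iSup_prod_le`). Hence the labeling is recovered with probability at most
`k (1 - (1 - h)^(2Δ) / (2k))^|S|`, the factor `k` accounting for the cyclic shift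
(`sum_prod_noiseProb_decoder_le`, `DetAlg.sum_success_le`).

Since `h` is at most `4δ²k` and at most `4δ` (`noiseHellinger_le`), the assumption on `t` makes `hΔ`
a small multiple of `log n`, so that a single guess errs with probability at least a small negative
power of `n`. The lower bound on `δ` keeps `Δ` below a power of `n` close to `1/2`. So `S` has
polynomially many more items than the inverse of this error probability, and the bound becomes
`exp(-n^c)`.
-/

namespace JointAlignment

/-! ### Guessing a label from independent observations -/

/-- Two probability vectors with a large Bhattacharyya coefficient overlap substantially. -/
lemma sq_sum_sqrt_mul_le_two_mul_sum_min {Z : Type*} [Fintype Z] (P R : Z → ℝ)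
    (hP : ∀ z, 0 ≤ P z) (hR : ∀ z, 0 ≤ R z) (hP1 : ∑ z, P z = 1) (hR1 : ∑ z, R z = 1) :
    (∑ z, √(P z * R z)) ^ 2 ≤ 2 * ∑ z, min (P z) (R z) := by
  have hmin : ∀ z, 0 ≤ min (P z) (R z) := fun z => le_min (hP z) (hR z)
  have hmax : ∀ z, 0 ≤ max (P z) (R z) := fun z => le_max_of_le_left (hP z)
  calc (∑ z, √(P z * R z)) ^ 2
      = (∑ z, √(min (P z) (R z)) * √(max (P z) (R z))) ^ 2 := by
        congr 1
        refine Finset.sum_congr rfl fun z _ => ?_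
        rw [← Real.sqrt_mul (hmin z), min_mul_max]
    _ ≤ (∑ z, √(min (P z) (R z)) ^ 2) * ∑ z, √(max (P z) (R z)) ^ 2 :=
        Finset.sum_mul_sq_le_sq_mul_sq _ _ _
    _ = (∑ z, min (P z) (R z)) * ∑ z, max (P z) (R z) := by
        simp only [Real.sq_sqrt (hmin _), Real.sq_sqrt (hmax _)]
    _ ≤ (∑ z, min (P z) (R z)) * 2 := by
        refine mul_le_mul_of_nonneg_left ?_ (Finset.sum_nonneg fun z _ => hmin z)
        calc ∑ z, max (P z) (R z) ≤ ∑ z, (P z + R z) :=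
              Finset.sum_le_sum fun z _ => max_le_add_of_nonneg (hP z) (hR z)
          _ = 2 := by rw [Finset.sum_add_distrib, hP1, hR1]; norm_num
    _ = 2 * ∑ z, min (P z) (R z) := mul_comm _ _

lemma sum_pi_prod {ι Y : Type*} [Fintype ι] [DecidableEq ι] [Fintype Y] (f : ι → Y → ℝ) :
    ∑ z : ι → Y, ∏ e, f e (z e) = ∏ e, ∑ y, f e y := by
  rw [Finset.prod_univ_sum, Fintype.piFinset_univ]

/-- Dividing by `Fintype.card X` shows that the maximum likelihood guess of a uniform label `x : X`,
given independent observations with laws `q e x`, errs with probability at least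
`β ^ (2 * Fintype.card ι) / (2 * Fintype.card X)`. The bound uses only that the two labels `x₀` and
`x₁` are hard to tell apart: their Bhattacharyya coefficients multiply over the observations. -/
lemma sum_iSup_prod_le {ι X Y : Type*} [Fintype ι] [DecidableEq ι] [Fintype X] [Fintype Y]
    (q : ι → X → Y → ℝ) (hq : ∀ e x y, 0 ≤ q e x y) (hq1 : ∀ e x, ∑ y, q e x y = 1)
    {x₀ x₁ : X} (hx : x₀ ≠ x₁) {β : ℝ} (hβ : 0 ≤ β)
    (hqβ : ∀ e, β ≤ ∑ y, √(q e x₀ y * q e x₁ y)) :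
    ∑ z : ι → Y, ⨆ x, ∏ e, q e x (z e)
      ≤ Fintype.card X - β ^ (2 * Fintype.card ι) / 2 := by
  classical
  have hP : ∀ x (z : ι → Y), 0 ≤ ∏ e, q e x (z e) := fun x z =>
    Finset.prod_nonneg fun e _ => hq e x (z e)
  have hP1 : ∀ x, ∑ z : ι → Y, ∏ e, q e x (z e) = 1 := fun x => by
    rw [sum_pi_prod (fun e => q e x)]; simp [hq1]
  -- Whichever label attains the maximum, `x₀` or `x₁` contributes a further term to the sum.
  have hsup : ∀ z : ι → Y, ⨆ x, ∏ e, q e x (z e)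
      ≤ ∑ x, ∏ e, q e x (z e) - min (∏ e, q e x₀ (z e)) (∏ e, q e x₁ (z e)) := by
    intro z
    have : Nonempty X := ⟨x₀⟩
    refine ciSup_le fun x => ?_
    have hpair : ∀ a b : X, a ≠ b →
        ∏ e, q e a (z e) + ∏ e, q e b (z e) ≤ ∑ x, ∏ e, q e x (z e) := fun a b hab => by
      rw [← Finset.sum_pair (f := fun x => ∏ e, q e x (z e)) hab]
      exact Finset.sum_le_sum_of_subset_of_nonneg (Finset.subset_univ _) fun i _ _ => hP i z
    by_cases h : x = x₀
    · subst h
      linarith [hpair x x₁ hx, min_le_right (∏ e, q e x (z e)) (∏ e, q e x₁ (z e))]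
    · linarith [hpair x x₀ h, min_le_left (∏ e, q e x₀ (z e)) (∏ e, q e x₁ (z e))]
  have hBC : β ^ Fintype.card ι
      ≤ ∑ z : ι → Y, √((∏ e, q e x₀ (z e)) * ∏ e, q e x₁ (z e)) := by
    calc β ^ Fintype.card ι = ∏ _e : ι, β := by simp
      _ ≤ ∏ e, ∑ y, √(q e x₀ y * q e x₁ y) :=
          Finset.prod_le_prod (fun _ _ => hβ) fun e _ => hqβ e
      _ = ∑ z : ι → Y, ∏ e, √(q e x₀ (z e) * q e x₁ (z e)) :=
          (sum_pi_prod fun e y => √(q e x₀ y * q e x₁ y)).symm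
      _ = _ := by
          refine Finset.sum_congr rfl fun z _ => ?_
          rw [← Finset.prod_mul_distrib, Real.sqrt_prod _ fun e _ => mul_nonneg (hq _ _ _) (hq _ _ _)]
  have hmin := sq_sum_sqrt_mul_le_two_mul_sum_min _ _ (hP x₀) (hP x₁) (hP1 x₀) (hP1 x₁)
  have hsq := pow_le_pow_left₀ (pow_nonneg hβ _) hBC 2
  rw [← pow_mul, mul_comm _ 2] at hsq
  calc ∑ z : ι → Y, ⨆ x, ∏ e, q e x (z e)
      ≤ ∑ z : ι → Y, (∑ x, ∏ e, q e x (z e)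
          - min (∏ e, q e x₀ (z e)) (∏ e, q e x₁ (z e))) := Finset.sum_le_sum fun z _ => hsup z
    _ = Fintype.card X - ∑ z : ι → Y, min (∏ e, q e x₀ (z e)) (∏ e, q e x₁ (z e)) := by
        rw [Finset.sum_sub_distrib, Finset.sum_comm]; simp [hP1]
    _ ≤ _ := by linarith

lemma sum_prod_fiberwise {E O Y : Type*} [Fintype E] [DecidableEq E] [Fintype O] [DecidableEq O]
    [Fintype Y] (owner : E → O) (F : ∀ o, ({e // owner e = o} → Y) → ℝ) :
    ∑ y : E → Y, ∏ o, F o (fun e => y e) = ∏ o, ∑ z, F o z := by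
  rw [Finset.prod_univ_sum, Fintype.piFinset_univ]
  exact Fintype.sum_equiv
    (((Equiv.sigmaFiberEquiv owner).symm.arrowCongr (Equiv.refl Y)).trans
      (Equiv.piCurry fun _ _ => Y)) _ _ fun y => rfl

/-! ### The Hellinger distance of the noise -/

lemma noiseProb_nonneg {k : ℕ} {δ : ℝ} (hk : 2 ≤ k) (h0 : 0 ≤ δ) (h1 : δ ≤ 1 / 4) (i : Fin k) :
    0 ≤ noiseProb k δ i := by
  have hk' : (2 : ℝ) ≤ k := by exact_mod_cast hk
  unfold noiseProb
  split_ifs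
  · positivity
  · rw [sub_nonneg, div_le_div_iff₀ (by linarith) (by linarith)]
    nlinarith

lemma sum_noiseProb {k : ℕ} (hk : 2 ≤ k) (δ : ℝ) : ∑ i : Fin k, noiseProb k δ i = 1 := by
  obtain ⟨m, rfl⟩ : ∃ m, k = m + 2 := ⟨k - 2, by omega⟩
  rw [Fin.sum_univ_succ]
  simp only [noiseProb, Fin.val_zero, Fin.val_succ, if_true, Nat.succ_ne_zero, if_false,
    Finset.sum_const, Finset.card_univ, Fintype.card_fin, nsmul_eq_mul, Nat.cast_add, Nat.cast_one,
    Nat.cast_ofNat]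
  have h1 : (m : ℝ) + 2 ≠ 0 := by positivity
  have h2 : (m : ℝ) + 2 - 1 ≠ 0 := by
    have : (0 : ℝ) ≤ m := by positivity
    linarith
  field_simp
  ring

lemma sum_noiseProb_sub {k : ℕ} [NeZero k] (hk : 2 ≤ k) (δ : ℝ) (a : Fin k) :
    ∑ y, noiseProb k δ (y - a) = 1 := by
  rw [← sum_noiseProb hk δ]
  exact Fintype.sum_equiv (Equiv.subRight a) _ _ fun y => rfl

/-- The squared difference of the square roots of the two values of `noiseProb k δ`. It is the
squared Hellinger distance (normalized to have maximum `1`) between the laws of the answers to one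
query under two hypotheses that predict different noiseless answers. -/
noncomputable def noiseHellinger (k : ℕ) (δ : ℝ) : ℝ :=
  (√(1 / (k : ℝ) + δ) - √(1 / (k : ℝ) - δ / ((k : ℝ) - 1))) ^ 2

/-- With `a ≥ b` the two noise probabilities, the first bound is `(√a - √b) ^ 2 ≤ a - b` and the
second one is `(√a - √b) ^ 2 ≤ (a - b) ^ 2 / a`, where `a - b ≤ 2 * δ` and `a ≥ 1 / k`. -/
lemma noiseHellinger_le {k : ℕ} {δ : ℝ} (hk : 2 ≤ k) (h0 : 0 ≤ δ) (h1 : δ ≤ 1 / 4) :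
    noiseHellinger k δ ≤ 2 * δ ∧ noiseHellinger k δ ≤ 4 * (δ ^ 2 * k) := by
  have hk' : (2 : ℝ) ≤ k := by exact_mod_cast hk
  have hb : 0 ≤ 1 / (k : ℝ) - δ / ((k : ℝ) - 1) := by
    rw [sub_nonneg, div_le_div_iff₀ (by linarith) (by linarith)]
    nlinarith
  have ha : 1 / (k : ℝ) ≤ 1 / (k : ℝ) + δ := by linarith
  have hk0 : 0 < 1 / (k : ℝ) := by positivity
  have hd : δ / ((k : ℝ) - 1) ≤ δ := div_le_self h0 (by linarith)
  have hd0 : 0 ≤ δ / ((k : ℝ) - 1) := div_nonneg h0 (by linarith)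
  have hkk : (1 / (k : ℝ)) * k = 1 := by field_simp
  unfold noiseHellinger
  obtain ⟨b, hbdef⟩ : ∃ b, 1 / (k : ℝ) - δ / ((k : ℝ) - 1) = b := ⟨_, rfl⟩
  have hab : b ≤ 1 / (k : ℝ) + δ ∧ 1 / (k : ℝ) + δ - b ≤ 2 * δ := by constructor <;> linarith
  rw [hbdef] at hb ⊢
  clear hbdef
  generalize 1 / (k : ℝ) + δ = a at *
  have ha0 : 0 ≤ a := by linarith
  have sa := Real.sq_sqrt ha0
  have sb := Real.sq_sqrt hb
  have hs := Real.sqrt_le_sqrt hab.1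
  have hsb := Real.sqrt_nonneg b
  have hsa := Real.sqrt_nonneg a
  constructor
  · nlinarith
  · have h1 : (√a - √b) ^ 2 * a ≤ 4 * δ ^ 2 := by
      calc (√a - √b) ^ 2 * a ≤ (√a - √b) ^ 2 * (√a + √b) ^ 2 := by
            gcongr; nlinarith
        _ = (a - b) ^ 2 := by rw [← mul_pow, ← sa, ← sb]; simp; ring
        _ ≤ (2 * δ) ^ 2 := by gcongr <;> linarith
        _ = _ := by ring
    calc (√a - √b) ^ 2 = (√a - √b) ^ 2 * (1 / (k : ℝ)) * k := by rw [mul_assoc, hkk, mul_one]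
      _ ≤ (√a - √b) ^ 2 * a * k := by gcongr
      _ ≤ 4 * δ ^ 2 * k := by gcongr
      _ = _ := by ring

/-- The Bhattacharyya coefficient of two shifts of the noise law is at least
`1 - noiseHellinger k δ` (with equality for distinct shifts). -/
lemma one_sub_noiseHellinger_le_sum_sqrt {k : ℕ} [NeZero k] {δ : ℝ} (hk : 2 ≤ k) (h0 : 0 ≤ δ)
    (h1 : δ ≤ 1 / 4) (a b : Fin k) :
    1 - noiseHellinger k δ ≤ ∑ y : Fin k, √(noiseProb k δ (y - a) * noiseProb k δ (y - b)) := by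
  have hn := fun i => noiseProb_nonneg (k := k) hk h0 h1 i
  -- `√(uv) = (u + v)/2 - (√u - √v)²/2`
  have hsq : ∀ y, √(noiseProb k δ (y - a) * noiseProb k δ (y - b))
      = (noiseProb k δ (y - a) + noiseProb k δ (y - b)) / 2
        - (√(noiseProb k δ (y - a)) - √(noiseProb k δ (y - b))) ^ 2 / 2 := fun y => by
    rw [Real.sqrt_mul (hn _), sub_sq, Real.sq_sqrt (hn _), Real.sq_sqrt (hn _)]; ring
  have hle : ∀ y, (√(noiseProb k δ (y - a)) - √(noiseProb k δ (y - b))) ^ 2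
      ≤ (if y = a then noiseHellinger k δ else 0) + if y = b then noiseHellinger k δ else 0 := by
    intro y
    have hpos : 0 ≤ noiseHellinger k δ := sq_nonneg _
    have e1 : ((y - a : Fin k) : ℕ) = 0 ↔ y = a := by
      rw [Fin.val_eq_zero_iff, sub_eq_zero]
    have e2 : ((y - b : Fin k) : ℕ) = 0 ↔ y = b := by
      rw [Fin.val_eq_zero_iff, sub_eq_zero]
    simp only [noiseProb, e1, e2]
    by_cases ha : y = a <;> by_cases hb : y = b
    · simp only [if_pos ha, if_pos hb]
      simp only [sub_self]
      linarith [hpos]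
    · rw [if_pos ha, if_pos ha, if_neg hb, if_neg hb, add_zero]
      rfl
    · rw [if_neg ha, if_neg ha, if_pos hb, if_pos hb, zero_add, noiseHellinger, sub_sq_comm]
    · simp only [if_neg ha, if_neg hb]
      simp
  have := Finset.sum_le_sum fun y (_ : y ∈ Finset.univ) => hle y
  simp only [Finset.sum_add_distrib, Finset.sum_ite_eq', Finset.mem_univ, if_true] at this
  simp only [hsq, Finset.sum_sub_distrib, ← Finset.sum_div, Finset.sum_add_distrib,
    sum_noiseProb_sub hk]
  linarith

section

variable {n k : ℕ}

/-! ### Independent sets of items of low degree -/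

/-- The pairs of `Q` that contain the item `v`. -/
def incident (Q : Finset (ItemPair n)) (v : Fin n) : Finset (ItemPair n) :=
  {e ∈ Q | e.1.1 = v ∨ e.1.2 = v}

lemma sum_card_incident_le (Q : Finset (ItemPair n)) :
    ∑ v, (incident Q v).card ≤ 2 * Q.card := by
  simp only [incident, Finset.card_filter]
  rw [Finset.sum_comm, mul_comm, ← smul_eq_mul]
  refine Finset.sum_le_card_nsmul _ _ _ fun e _ => ?_
  rw [← Finset.card_filter]
  refine (Finset.card_le_card (t := {e.1.1, e.1.2}) fun v hv => ?_).trans Finset.card_le_two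
  simp only [Finset.mem_filter, Finset.mem_univ, true_and] at hv
  simp only [Finset.mem_insert, Finset.mem_singleton]
  exact hv.imp Eq.symm Eq.symm

/-- `S` is independent in the graph on the items with edge set `Q`. -/
def IsIndep (Q : Finset (ItemPair n)) (S : Finset (Fin n)) : Prop :=
  ∀ e ∈ Q, ¬(e.1.1 ∈ S ∧ e.1.2 ∈ S)

/-- A maximum independent subset of a set of vertices of degree at most `Δ` contains at least one
in `Δ + 1` of them. -/
lemma exists_isIndep_of_card_incident_le (Q : Finset (ItemPair n)) (L : Finset (Fin n)) (Δ : ℕ)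
    (hL : ∀ v ∈ L, (incident Q v).card ≤ Δ) :
    ∃ S ⊆ L, IsIndep Q S ∧ L.card ≤ S.card * (Δ + 1) := by
  classical
  obtain ⟨S, hS, hmax⟩ := Finset.exists_max_image (L.powerset.filter (IsIndep Q)) Finset.card
    ⟨∅, by simp [IsIndep]⟩
  simp only [Finset.mem_filter, Finset.mem_powerset] at hS hmax
  refine ⟨S, hS.1, hS.2, ?_⟩
  -- By maximality every vertex of `L` lies in `S` or is joined by a query to a vertex of `S`.
  have hcover : L ⊆ S.biUnion fun s => insert s
      ((incident Q s).image fun e => if e.1.1 = s then e.1.2 else e.1.1) := by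
    intro v hv
    by_cases hvS : v ∈ S
    · exact Finset.mem_biUnion.2 ⟨v, hvS, Finset.mem_insert_self _ _⟩
    · have hnot : ¬IsIndep Q (insert v S) := fun h => by
        have := hmax _ ⟨Finset.insert_subset hv hS.1, h⟩
        rw [Finset.card_insert_of_notMem hvS] at this
        omega
      simp only [IsIndep, not_forall, not_not, Finset.mem_insert] at hnot
      obtain ⟨e, he, h1, h2⟩ := hnot
      have hne := e.2.ne
      have hind := hS.2 e he
      simp only [Finset.mem_biUnion, Finset.mem_insert, Finset.mem_image, incident,
        Finset.mem_filter]
      rcases h1 with h1 | h1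
      · have h2' : e.1.2 ∈ S := h2.resolve_left fun h => hne (h1.trans h.symm)
        exact ⟨e.1.2, h2', Or.inr ⟨e, ⟨he, Or.inr rfl⟩, by rw [if_neg hne, h1]⟩⟩
      · have h2' : e.1.2 = v := h2.resolve_right fun h => hind ⟨h1, h⟩
        exact ⟨e.1.1, h1, Or.inr ⟨e, ⟨he, Or.inl rfl⟩, by rw [if_pos rfl, h2']⟩⟩
  refine (Finset.card_le_card hcover).trans (Finset.card_biUnion_le_card_mul _ _ _ fun s hs => ?_)
  refine (Finset.card_insert_le _ _).trans (Nat.succ_le_succ ?_)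
  exact Finset.card_image_le.trans (hL s (hS.1 hs))

/-- The average degree is at most `2 * t / n`, so at least half of the items have degree at most
`4 * t / n` (a division in `ℕ`); the independent set is found among them. -/
lemma exists_large_isIndep (Q : Finset (ItemPair n)) {t : ℕ} (hQ : Q.card ≤ t) :
    ∃ S : Finset (Fin n), IsIndep Q S ∧ (∀ v ∈ S, (incident Q v).card ≤ 4 * t / n) ∧
      n ≤ 2 * (S.card * (4 * t / n + 1)) := by
  classical
  rcases Nat.eq_zero_or_pos n with rfl | hn
  · exact ⟨∅, by simp [IsIndep], by simp, by simp⟩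
  set Δ := 4 * t / n with hΔ
  have hlt : 4 * t < n * (Δ + 1) := Nat.lt_mul_div_succ _ hn
  set L : Finset (Fin n) := {v | (incident Q v).card ≤ Δ} with hLdef
  obtain ⟨S, hSL, hS, hc⟩ := exists_isIndep_of_card_incident_le Q L Δ (by simp [hLdef])
  refine ⟨S, hS, fun v hv => by simpa [hLdef] using hSL hv, ?_⟩
  have hcompl : Lᶜ.card * (Δ + 1) ≤ 2 * t := by
    calc Lᶜ.card * (Δ + 1) ≤ ∑ v ∈ Lᶜ, (incident Q v).card := by
          rw [← smul_eq_mul]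
          refine Finset.card_nsmul_le_sum _ _ _ fun v hv => ?_
          simp only [hLdef, Finset.mem_compl, Finset.mem_filter, Finset.mem_univ, true_and,
            not_le] at hv
          exact hv
      _ ≤ ∑ v, (incident Q v).card := Finset.sum_le_sum_of_subset (Finset.subset_univ _)
      _ ≤ 2 * t := (sum_card_incident_le Q).trans (by omega)
  have hadd : L.card + Lᶜ.card = n := by rw [Finset.card_add_card_compl, Fintype.card_fin]
  have h2 : 2 * Lᶜ.card < n := by
    refine Nat.lt_of_mul_lt_mul_right (a := Δ + 1) ?_
    linarith
  omega

/-! ### Decoding the labels on an independent set -/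

/-- The noiseless answer to the query `e`. It is set to `0` on the pairs outside `Q`, so that
`η ↦ η + queryShift Q g` turns the noise into the answers on `Q` and leaves the noise on all other
pairs unchanged, independently of `g`. -/
def queryShift [NeZero k] (Q : Finset (ItemPair n)) (g : Fin n → Fin k) (e : ItemPair n) : Fin k :=
  if e ∈ Q then g e.1.1 - g e.1.2 else 0

/-- The endpoint in `S` of a queried pair, and `none` for a pair that is not queried or does not
meet `S`. If `S` is independent, the choice of the first endpoint in case of a tie is void. -/
def owner (Q : Finset (ItemPair n)) (S : Finset (Fin n)) (e : ItemPair n) : Option (Fin n) :=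
  if e ∈ Q then
    if e.1.1 ∈ S then some e.1.1 else if e.1.2 ∈ S then some e.1.2 else none
  else none

lemma owner_eq_some {Q : Finset (ItemPair n)} {S : Finset (Fin n)} {e : ItemPair n} {v : Fin n}
    (h : owner Q S e = some v) : v ∈ S ∧ e ∈ incident Q v := by
  unfold owner at h
  split_ifs at h with hQ h1 h2
  · obtain rfl := Option.some.inj h
    exact ⟨h1, by simp [incident, hQ]⟩
  · obtain rfl := Option.some.inj h
    exact ⟨h2, by simp [incident, hQ]⟩

lemma queryShift_congr_of_owner_eq_none [NeZero k] {Q : Finset (ItemPair n)} {S : Finset (Fin n)}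
    {g g' : Fin n → Fin k} (hg : ∀ v ∉ S, g v = g' v) {e : ItemPair n}
    (h : owner Q S e = none) : queryShift Q g e = queryShift Q g' e := by
  unfold owner at h
  unfold queryShift
  split_ifs at h with hQ h1 h2
  · rw [if_pos hQ, if_pos hQ, hg _ h1, hg _ h2]
  · rw [if_neg hQ, if_neg hQ]

lemma queryShift_update_congr [NeZero k] {Q : Finset (ItemPair n)} {S : Finset (Fin n)}
    (hS : IsIndep Q S) {g g' : Fin n → Fin k} (hg : ∀ v ∉ S, g v = g' v) {e : ItemPair n}
    {v : Fin n} (h : owner Q S e = some v) (x : Fin k) :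
    queryShift Q (Function.update g v x) e = queryShift Q (Function.update g' v x) e := by
  have hu : ∀ w, w = v ∨ w ∉ S → Function.update g v x w = Function.update g' v x w := by
    intro w hw
    by_cases hwv : w = v
    · subst hwv; simp
    · simp [Function.update_of_ne hwv, hg _ (hw.resolve_left hwv)]
  unfold owner at h
  unfold queryShift
  split_ifs at h with hQ h1 h2
  · rw [if_pos hQ, if_pos hQ, hu _ (Or.inl (Option.some.inj h)),
      hu _ (Or.inr fun h2 => hS e hQ ⟨h1, h2⟩)]
  · rw [if_pos hQ, if_pos hQ, hu _ (Or.inl (Option.some.inj h)), hu _ (Or.inr h1)]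

/-- The likelihood of the answers `z` on the pairs with owner `o`, maximized over the label of `v`
if `o = some v`. If `S` is independent, it depends only on the labels outside `S`. -/
noncomputable def blockWeight [NeZero k] (δ : ℝ) (Q : Finset (ItemPair n)) (S : Finset (Fin n))
    (g : Fin n → Fin k) : ∀ o : Option (Fin n), ({e // owner Q S e = o} → Fin k) → ℝ
  | none, z => ∏ e : {e // owner Q S e = none}, noiseProb k δ (z e - queryShift Q g e)
  | some v, z => ⨆ x, ∏ e : {e // owner Q S e = some v},
      noiseProb k δ (z e - queryShift Q (Function.update g v x) e)

lemma blockWeight_congr [NeZero k] (δ : ℝ) {Q : Finset (ItemPair n)} {S : Finset (Fin n)}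
    (hS : IsIndep Q S) {g g' : Fin n → Fin k} (hg : ∀ v ∉ S, g v = g' v) (o : Option (Fin n)) :
    blockWeight δ Q S g o = blockWeight δ Q S g' o := by
  funext z
  cases o with
  | none =>
    exact Finset.prod_congr rfl fun e _ => by rw [queryShift_congr_of_owner_eq_none hg e.2]
  | some v =>
    exact congrArg iSup <| funext fun x => Finset.prod_congr rfl fun e _ => by
      rw [queryShift_update_congr hS hg e.2]

lemma prod_noiseProb_le_prod_blockWeight [NeZero k] {δ : ℝ} (hk : 2 ≤ k) (h0 : 0 ≤ δ)
    (h1 : δ ≤ 1 / 4) (Q : Finset (ItemPair n)) (S : Finset (Fin n)) (g : Fin n → Fin k)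
    (y : ItemPair n → Fin k) :
    ∏ e, noiseProb k δ (y e - queryShift Q g e)
      ≤ ∏ o, blockWeight δ Q S g o (fun e => y e) := by
  rw [← Fintype.prod_fiberwise (owner Q S)]
  refine Finset.prod_le_prod
    (fun o _ => Finset.prod_nonneg fun e _ => noiseProb_nonneg hk h0 h1 _) fun o _ => ?_
  cases o with
  | none => exact le_rfl
  | some v =>
    refine le_of_eq_of_le ?_ (le_ciSup (Set.finite_range _).bddAbove (g v))
    rw [Function.update_eq_self]

lemma blockWeight_nonneg [NeZero k] {δ : ℝ} (hk : 2 ≤ k) (h0 : 0 ≤ δ)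
    (h1 : δ ≤ 1 / 4) (Q : Finset (ItemPair n)) (S : Finset (Fin n)) (g : Fin n → Fin k)
    (o : Option (Fin n)) (z : {e // owner Q S e = o} → Fin k) : 0 ≤ blockWeight δ Q S g o z := by
  cases o with
  | none => exact Finset.prod_nonneg fun e _ => noiseProb_nonneg hk h0 h1 _
  | some v =>
    exact Real.iSup_nonneg fun x => Finset.prod_nonneg fun e _ => noiseProb_nonneg hk h0 h1 _

lemma sum_blockWeight_none [NeZero k] (hk : 2 ≤ k) (δ : ℝ)
    (Q : Finset (ItemPair n)) (S : Finset (Fin n)) (g : Fin n → Fin k) :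
    ∑ z, blockWeight δ Q S g none z = 1 := by
  simp only [blockWeight]
  rw [sum_pi_prod fun (e : {e // owner Q S e = none}) y => noiseProb k δ (y - queryShift Q g e)]
  simp [sum_noiseProb_sub hk]

lemma sum_blockWeight_some_of_notMem [NeZero k] (δ : ℝ)
    (Q : Finset (ItemPair n)) {S : Finset (Fin n)} (g : Fin n → Fin k) {v : Fin n} (hv : v ∉ S) :
    ∑ z, blockWeight δ Q S g (some v) z = 1 := by
  have : IsEmpty {e // owner Q S e = some v} := ⟨fun e => hv (owner_eq_some e.2).1⟩
  simp [blockWeight]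

lemma sum_blockWeight_some_le [NeZero k] {δ : ℝ} (hk : 2 ≤ k) (h0 : 0 ≤ δ) (h1 : δ ≤ 1 / 4)
    (Q : Finset (ItemPair n)) (S : Finset (Fin n)) (g : Fin n → Fin k) (v : Fin n) {Δ : ℕ}
    (hΔ : (incident Q v).card ≤ Δ) :
    ∑ z, blockWeight δ Q S g (some v) z ≤ k - (1 - noiseHellinger k δ) ^ (2 * Δ) / 2 := by
  have hh0 : 0 ≤ noiseHellinger k δ := sq_nonneg _
  have hh1 := (noiseHellinger_le hk h0 h1).1
  have hcard : Fintype.card {e // owner Q S e = some v} ≤ Δ := by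
    rw [Fintype.card_subtype]
    refine (Finset.card_le_card fun e he => ?_).trans hΔ
    exact (owner_eq_some (Finset.mem_filter.1 he).2).2
  have hx : (⟨0, by omega⟩ : Fin k) ≠ ⟨1, by omega⟩ := by simp
  have := sum_iSup_prod_le
    (fun (e : {e // owner Q S e = some v}) x y =>
      noiseProb k δ (y - queryShift Q (Function.update g v x) e))
    (fun e x y => noiseProb_nonneg hk h0 h1 _) (fun e x => sum_noiseProb_sub hk δ _) hx
    (β := 1 - noiseHellinger k δ) (by linarith)
    (fun e => one_sub_noiseHellinger_le_sum_sqrt hk h0 h1 _ _)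
  rw [Fintype.card_fin] at this
  refine this.trans ?_
  have hpow : (1 - noiseHellinger k δ) ^ (2 * Δ)
      ≤ (1 - noiseHellinger k δ) ^ (2 * Fintype.card {e // owner Q S e = some v}) :=
    pow_le_pow_of_le_one (by linarith) (by linarith) (by omega)
  linarith

lemma sum_prod_blockWeight_le [NeZero k] {δ : ℝ} (hk : 2 ≤ k) (h0 : 0 ≤ δ) (h1 : δ ≤ 1 / 4)
    {Q : Finset (ItemPair n)} {S : Finset (Fin n)} (g : Fin n → Fin k) {Δ : ℕ}
    (hΔ : ∀ v ∈ S, (incident Q v).card ≤ Δ) :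
    ∑ y : ItemPair n → Fin k, ∏ o, blockWeight δ Q S g o (fun e => y e)
      ≤ (k - (1 - noiseHellinger k δ) ^ (2 * Δ) / 2) ^ S.card := by
  rw [sum_prod_fiberwise (owner Q S), Fintype.prod_option, sum_blockWeight_none hk, one_mul]
  calc ∏ v, ∑ z, blockWeight δ Q S g (some v) z
      ≤ ∏ v, (if v ∈ S then (k : ℝ) - (1 - noiseHellinger k δ) ^ (2 * Δ) / 2 else 1) := by
        refine Finset.prod_le_prod
          (fun v _ => Finset.sum_nonneg fun z _ => blockWeight_nonneg hk h0 h1 _ _ _ _ _)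
          fun v _ => ?_
        split_ifs with hv
        · exact sum_blockWeight_some_le hk h0 h1 Q S g v (hΔ v hv)
        · exact (sum_blockWeight_some_of_notMem δ Q g hv).le
    _ = _ := by simp [Finset.prod_ite_mem]

/-- If `f` depends only on the labels outside `S`, then each of its values is attained at least
`k ^ S.card` times. -/
lemma card_pow_mul_le_sum {S : Finset (Fin n)} (f : (Fin n → Fin k) → ℝ) (hf : ∀ g, 0 ≤ f g)
    (hfS : ∀ g g' : Fin n → Fin k, (∀ v ∉ S, g v = g' v) → f g = f g') (g : Fin n → Fin k) :
    (k : ℝ) ^ S.card * f g ≤ ∑ g', f g' := by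
  classical
  set T := Fintype.piFinset fun v => if v ∈ S then Finset.univ else {g v} with hT
  have hcard : T.card = k ^ S.card := by
    simp [hT, Fintype.card_piFinset, apply_ite Finset.card, Finset.prod_ite_mem]
  calc (k : ℝ) ^ S.card * f g = ∑ g' ∈ T, f g' := by
        rw [Finset.sum_congr rfl fun g' hg' => hfS g' g fun v hv => ?_]
        · simp [hcard]
        · have := Fintype.mem_piFinset.1 hg' v
          simpa [hv] using this
    _ ≤ ∑ g', f g' := Finset.sum_le_sum_of_subset_of_nonneg (Finset.subset_univ _)
        fun g' _ _ => hf g'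

/-- Divided by `k ^ n`, the left side is the probability that the decoder `φ` recovers a uniformly
random labeling exactly. The likelihood of `φ y` is at most the product of the block weights, and
replacing the labels of `φ y` outside `S` by a sum over all labels outside `S` decouples the
blocks. -/
lemma sum_prod_noiseProb_decoder_le [NeZero k] {δ : ℝ} (hk : 2 ≤ k) (h0 : 0 ≤ δ) (h1 : δ ≤ 1 / 4)
    {Q : Finset (ItemPair n)} {S : Finset (Fin n)} (hS : IsIndep Q S) {Δ : ℕ}
    (hΔ : ∀ v ∈ S, (incident Q v).card ≤ Δ) (φ : (ItemPair n → Fin k) → Fin n → Fin k) :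
    ∑ y, ∏ e, noiseProb k δ (y e - queryShift Q (φ y) e)
      ≤ (k : ℝ) ^ n * (1 - (1 - noiseHellinger k δ) ^ (2 * Δ) / (2 * k)) ^ S.card := by
  have hk0 : (0 : ℝ) < k := by exact_mod_cast (by omega : 0 < k)
  have hnn : ∀ g (y : ItemPair n → Fin k), 0 ≤ ∏ o, blockWeight δ Q S g o (fun e => y e) :=
    fun g y => Finset.prod_nonneg fun o _ => blockWeight_nonneg hk h0 h1 _ _ _ _ _
  have key : (k : ℝ) ^ S.card * ∑ y, ∏ e, noiseProb k δ (y e - queryShift Q (φ y) e)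
      ≤ (k : ℝ) ^ n * (k - (1 - noiseHellinger k δ) ^ (2 * Δ) / 2) ^ S.card := by
    calc (k : ℝ) ^ S.card * ∑ y, ∏ e, noiseProb k δ (y e - queryShift Q (φ y) e)
        ≤ ∑ y : ItemPair n → Fin k,
            (k : ℝ) ^ S.card * ∏ o, blockWeight δ Q S (φ y) o (fun e => y e) := by
          rw [Finset.mul_sum]
          gcongr with y
          exact prod_noiseProb_le_prod_blockWeight hk h0 h1 Q S (φ y) y
      _ ≤ ∑ y : ItemPair n → Fin k, ∑ g, ∏ o, blockWeight δ Q S g o (fun e => y e) := by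
          refine Finset.sum_le_sum fun y _ => card_pow_mul_le_sum
            (fun g => ∏ o, blockWeight δ Q S g o (fun e => y e)) (fun g => hnn g y)
            (fun g g' hg => Finset.prod_congr rfl fun o _ => ?_) (φ y)
          rw [blockWeight_congr δ hS hg]
      _ = ∑ g, ∑ y : ItemPair n → Fin k, ∏ o, blockWeight δ Q S g o (fun e => y e) :=
          Finset.sum_comm
      _ ≤ ∑ _g : Fin n → Fin k, (k - (1 - noiseHellinger k δ) ^ (2 * Δ) / 2) ^ S.card :=
          Finset.sum_le_sum fun g _ => sum_prod_blockWeight_le hk h0 h1 g hΔ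
      _ = _ := by simp
  have hfac : (k : ℝ) - (1 - noiseHellinger k δ) ^ (2 * Δ) / 2
      = k * (1 - (1 - noiseHellinger k δ) ^ (2 * Δ) / (2 * k)) := by
    field_simp
  rw [hfac, mul_pow, mul_left_comm] at key
  exact le_of_mul_le_mul_left key (by positivity)

/-! ### The success probability of an algorithm -/

instance isFiniteMeasure_noiseLaw (k : ℕ) (δ : ℝ) : IsFiniteMeasure (noiseLaw k δ) := by
  unfold noiseLaw
  refine ⟨?_⟩
  simp only [Measure.finsetSum_apply, Measure.smul_apply, measure_univ, smul_eq_mul, mul_one]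
  exact ENNReal.sum_lt_top.2 fun i _ => ENNReal.ofReal_lt_top

instance isFiniteMeasure_jointNoiseLaw (n k : ℕ) (δ : ℝ) :
    IsFiniteMeasure (jointNoiseLaw n k δ) := by
  unfold jointNoiseLaw; infer_instance

lemma noiseLaw_singleton (k : ℕ) (δ : ℝ) (i : Fin k) :
    noiseLaw k δ {i} = ENNReal.ofReal (noiseProb k δ i) := by
  simp [noiseLaw, Measure.finsetSum_apply, Set.indicator_apply]

lemma jointNoiseLaw_real_singleton {δ : ℝ} (hk : 2 ≤ k) (h0 : 0 ≤ δ) (h1 : δ ≤ 1 / 4)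
    (η : ItemPair n → Fin k) :
    (jointNoiseLaw n k δ).real {η} = ∏ e, noiseProb k δ (η e) := by
  simp [Measure.real, jointNoiseLaw, Measure.pi_singleton, noiseLaw_singleton,
    ENNReal.toReal_prod, noiseProb_nonneg hk h0 h1]

lemma jointNoiseLaw_real_setOf {δ : ℝ} (hk : 2 ≤ k) (h0 : 0 ≤ δ) (h1 : δ ≤ 1 / 4)
    (p : (ItemPair n → Fin k) → Prop) [DecidablePred p] :
    (jointNoiseLaw n k δ).real {η | p η}
      = ∑ η, if p η then ∏ e, noiseProb k δ (η e) else 0 := by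
  rw [← Finset.sum_filter, ← Finset.coe_filter_univ, ← sum_measureReal_singleton]
  simp only [jointNoiseLaw_real_singleton hk h0 h1]

lemma DetAlg.result_sub_queryShift [NeZero k] (D : DetAlg n k) (g : Fin n → Fin k)
    (y : ItemPair n → Fin k) :
    D.result g (fun e => y e - queryShift D.queries g e) = D.output fun p => y p.1 := by
  unfold DetAlg.result
  congr 1
  funext p
  simp only [measurement, queryShift, p.2, if_true]
  abel

/-- The factor `k` on the right is a union bound over the cyclic shifts. -/
lemma DetAlg.sum_success_le [NeZero k] {δ : ℝ} (hk : 2 ≤ k) (h0 : 0 ≤ δ) (h1 : δ ≤ 1 / 4)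
    (D : DetAlg n k) {S : Finset (Fin n)} (hS : IsIndep D.queries S) {Δ : ℕ}
    (hΔ : ∀ v ∈ S, (incident D.queries v).card ≤ Δ) :
    ∑ g, (jointNoiseLaw n k δ).real {η | EqUpToShift (D.result g η) g}
      ≤ (k : ℝ) ^ n * (k * (1 - (1 - noiseHellinger k δ) ^ (2 * Δ) / (2 * k)) ^ S.card) := by
  classical
  set out : (ItemPair n → Fin k) → Fin n → Fin k := fun y => D.output fun p => y p.1
  have hstep : ∀ g : Fin n → Fin k,
      (jointNoiseLaw n k δ).real {η | EqUpToShift (D.result g η) g}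
        ≤ ∑ a, ∑ y, if g = (fun v => out y v - a)
            then ∏ e, noiseProb k δ (y e - queryShift D.queries g e) else 0 := by
    intro g
    rw [jointNoiseLaw_real_setOf hk h0 h1, Finset.sum_comm]
    -- Sum over the answers instead of the noise.
    rw [← Fintype.sum_equiv (Equiv.subRight (queryShift D.queries g))
      (fun y => if EqUpToShift (out y) g
        then ∏ e, noiseProb k δ (y e - queryShift D.queries g e) else 0) _ fun y => ?_]
    · refine Finset.sum_le_sum fun y _ => ?_
      have hp : 0 ≤ ∏ e, noiseProb k δ (y e - queryShift D.queries g e) :=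
        Finset.prod_nonneg fun e _ => noiseProb_nonneg hk h0 h1 _
      split_ifs with h
      · obtain ⟨a, ha⟩ := h
        refine le_of_eq_of_le ?_ (Finset.single_le_sum (fun b _ => ?_) (Finset.mem_univ a))
        · rw [if_pos]
          funext v
          rw [ha, add_sub_cancel_right]
        · split_ifs
          · exact hp
          · exact le_rfl
      · exact Finset.sum_nonneg fun b _ => by
          split_ifs
          · exact hp
          · exact le_rfl
    · have hout : out y = D.result g fun e => y e - queryShift D.queries g e :=
        (D.result_sub_queryShift g y).symm
      rw [hout]
      rfl
  calc ∑ g, (jointNoiseLaw n k δ).real {η | EqUpToShift (D.result g η) g}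
      ≤ ∑ g, ∑ a, ∑ y, (if g = (fun v => out y v - a)
            then ∏ e, noiseProb k δ (y e - queryShift D.queries g e) else 0) :=
        Finset.sum_le_sum fun g _ => hstep g
    _ = ∑ a : Fin k, ∑ y, ∏ e,
          noiseProb k δ (y e - queryShift D.queries (fun v => out y v - a) e) := by
        rw [Finset.sum_comm]
        refine Finset.sum_congr rfl fun a _ => ?_
        rw [Finset.sum_comm]
        simp
    _ ≤ ∑ _a : Fin k,
          (k : ℝ) ^ n * (1 - (1 - noiseHellinger k δ) ^ (2 * Δ) / (2 * k)) ^ S.card :=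
        Finset.sum_le_sum fun a _ =>
          sum_prod_noiseProb_decoder_le hk h0 h1 hS hΔ fun y v => out y v - a
    _ = _ := by simp; ring

instance finite_detAlg (n k : ℕ) : Finite (DetAlg n k) := by
  refine Finite.of_injective
    (β := Σ Q : Finset (ItemPair n), (Q → Fin k) → (Fin n → Fin k))
    (fun D => ⟨D.queries, D.output⟩) ?_
  rintro ⟨Q, f⟩ ⟨Q', f'⟩ h
  simp only [Sigma.mk.injEq] at h
  obtain ⟨rfl, h⟩ := h
  rw [eq_of_heq h]

instance discreteMeasurableSpace_detAlg (n k : ℕ) : DiscreteMeasurableSpace (DetAlg n k) :=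
  ⟨fun _ => trivial⟩

lemma RandAlg.measurableSet_success (A : RandAlg.{u} n k) (g : Fin n → Fin k) :
    MeasurableSet {x : A.Coins × (ItemPair n → Fin k) |
      EqUpToShift ((A.run x.1).result g x.2) g} := by
  have hmap : Measurable fun x : A.Coins × (ItemPair n → Fin k) => (A.run x.1, x.2) :=
    (A.measurable_run.comp measurable_fst).prodMk measurable_snd
  exact hmap (MeasurableSet.of_discrete
    (s := {x : DetAlg n k × (ItemPair n → Fin k) | EqUpToShift (x.1.result g x.2) g}))

/-- The minimum over the labelings is at most the average, which can be bounded for every outcome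
of the coins separately. -/
lemma RandAlg.successProb_le_of_forall_sum_le [NeZero k] {δ C : ℝ} (A : RandAlg.{u} n k)
    (hC : ∀ ω, ∑ g, (jointNoiseLaw n k δ).real {η | EqUpToShift ((A.run ω).result g η) g}
      ≤ (k : ℝ) ^ n * C) : A.successProb δ ≤ C := by
  have hk0 : (0 : ℝ) < k := by exact_mod_cast Nat.pos_of_neZero k
  have hintegral : ∀ g, A.successProbAt δ g
      = ∫ ω, (jointNoiseLaw n k δ).real {η | EqUpToShift ((A.run ω).result g η) g} ∂A.coinLaw :=
    fun g => by
      have hs := A.measurableSet_success g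
      rw [RandAlg.successProbAt, Measure.real, Measure.prod_apply hs,
        ← integral_toReal (measurable_measure_prodMk_left hs).aemeasurable
          (ae_of_all _ fun ω => measure_lt_top _ _)]
      rfl
  have hint : ∀ g, Integrable (fun ω =>
      (jointNoiseLaw n k δ).real {η | EqUpToShift ((A.run ω).result g η) g}) A.coinLaw :=
    fun g => Integrable.of_bound
      (measurable_measure_prodMk_left
        (A.measurableSet_success g)).ennreal_toReal.aestronglyMeasurable
      ((jointNoiseLaw n k δ).real Set.univ) (ae_of_all _ fun ω => by
        rw [Real.norm_of_nonneg measureReal_nonneg]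
        exact measureReal_mono (Set.subset_univ _))
  have hsum : ∑ g, A.successProbAt δ g ≤ (k : ℝ) ^ n * C := by
    simp only [hintegral]
    rw [← integral_finsetSum _ fun g _ => hint g]
    calc _ ≤ ∫ _ω, (k : ℝ) ^ n * C ∂A.coinLaw :=
          integral_mono (integrable_finsetSum _ fun g _ => hint g) (integrable_const _) hC
      _ = _ := by simp
  have hmin : (k : ℝ) ^ n * A.successProb δ ≤ ∑ g, A.successProbAt δ g := by
    have := Finset.card_nsmul_le_sum (Finset.univ : Finset (Fin n → Fin k))
      (fun g => A.successProbAt δ g) (A.successProb δ)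
      fun g _ => ciInf_le (Set.finite_range _).bddBelow g
    simpa using this
  exact le_of_mul_le_mul_left (hmin.trans hsum) (by positivity)

/-- The bound for fixed parameters; `4 * t / n` is a division in `ℕ`. -/
lemma RandAlg.successProb_le {δ : ℝ} (hk : 2 ≤ k) (h0 : 0 ≤ δ) (h1 : δ ≤ 1 / 4)
    {t : ℕ} (A : RandAlg.{u} n k) (hA : A.MakesAtMost t) :
    A.successProb δ ≤ k * Real.exp
      (-(n * (1 - noiseHellinger k δ) ^ (2 * (4 * t / n)) / (4 * k * ((4 * t / n : ℕ) + 1)))) := by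
  have : NeZero k := ⟨by omega⟩
  have hk0 : (2 : ℝ) ≤ k := by exact_mod_cast hk
  refine A.successProb_le_of_forall_sum_le fun ω => ?_
  obtain ⟨S, hS, hdeg, hcard⟩ := exists_large_isIndep (A.run ω).queries (hA ω)
  refine ((A.run ω).sum_success_le hk h0 h1 hS hdeg).trans ?_
  set Δ := 4 * t / n
  have hh0 : 0 ≤ noiseHellinger k δ := sq_nonneg _
  have hh1 := (noiseHellinger_le hk h0 h1).1
  set r := (1 - noiseHellinger k δ) ^ (2 * Δ)
  have hr0 : 0 ≤ r := pow_nonneg (by linarith) _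
  have hr1 : r ≤ 1 := pow_le_one₀ (by linarith) (by linarith)
  have hcard' : (n : ℝ) ≤ 2 * (S.card * (Δ + 1)) := by exact_mod_cast hcard
  have hrk : r / (2 * k) ≤ 1 := by rw [div_le_one (by linarith)]; linarith
  gcongr
  calc (1 - r / (2 * k)) ^ S.card ≤ Real.exp (-(r / (2 * k))) ^ S.card :=
        pow_le_pow_left₀ (by linarith) (Real.one_sub_le_exp_neg _) _
    _ = Real.exp (-(S.card * (r / (2 * k)))) := by rw [← Real.exp_nat_mul]; ring_nf
    _ ≤ _ := by
      rw [Real.exp_le_exp, neg_le_neg_iff, ← mul_div_assoc, div_le_div_iff₀ (by positivity)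
        (by positivity)]
      have := mul_le_mul_of_nonneg_right hcard' (by positivity : 0 ≤ 2 * (r * k))
      linarith

end

/-! ### Asymptotics -/

lemma exp_neg_two_mul_le_one_sub {h : ℝ} (h0 : 0 ≤ h) (h1 : h ≤ 1 / 2) :
    Real.exp (-(2 * h)) ≤ 1 - h := by
  rw [Real.exp_neg, inv_le_comm₀ (Real.exp_pos _) (by linarith)]
  refine le_trans ?_ (Real.add_one_le_exp _)
  rw [inv_le_iff_one_le_mul₀ (by linarith)]
  nlinarith

lemma eventually_rpow_estimates :
    ∀ᶠ n : ℕ in atTop, 1 ≤ Real.log n ∧ 1 / 100 * Real.log n * (n : ℝ) ^ (1 / 2 : ℝ) + 1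
        ≤ (n : ℝ) ^ (3 / 5 : ℝ) ∧
      1 / 20 * Real.log n + (n : ℝ) ^ (1 / 10 : ℝ) ≤ (n : ℝ) ^ (3 / 10 : ℝ) / 4 := by
  have hcast := tendsto_natCast_atTop_atTop (R := ℝ)
  have h1 := ((isLittleO_log_rpow_atTop (r := 1 / 10) (by norm_num)).bound one_pos)
  have h2 := (tendsto_rpow_atTop (y := 1 / 10) (by norm_num)).eventually_ge_atTop 8
  have h3 := Real.tendsto_log_atTop.eventually_ge_atTop 1
  have := (h1.and (h2.and (h3.and (eventually_gt_atTop 0))))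
  filter_upwards [hcast.eventually this] with n hn
  obtain ⟨hlog, h8, hl1, hpos⟩ := hn
  generalize (n : ℝ) = x at *
  rw [Real.norm_of_nonneg (by linarith), Real.norm_of_nonneg (by positivity), one_mul] at hlog
  have e5 : x ^ (3 / 5 : ℝ) = x ^ (1 / 2 : ℝ) * x ^ (1 / 10 : ℝ) := by
    rw [← Real.rpow_add hpos]; norm_num
  have e3 : x ^ (3 / 10 : ℝ) = x ^ (1 / 10 : ℝ) * x ^ (1 / 10 : ℝ) * x ^ (1 / 10 : ℝ) := by
    rw [← Real.rpow_add hpos, ← Real.rpow_add hpos]; norm_num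
  have e2 : 1 ≤ x ^ (1 / 2 : ℝ) := by
    have : x ^ (1 / 2 : ℝ) = (x ^ (1 / 10 : ℝ)) ^ 5 := by
      rw [← Real.rpow_natCast, ← Real.rpow_mul hpos.le]; norm_num
    rw [this]
    exact one_le_pow₀ (by linarith)
  refine ⟨hl1, ?_, ?_⟩
  · rw [e5]; nlinarith
  · rw [e3]
    generalize x ^ (1 / 10 : ℝ) = w at *
    nlinarith [mul_le_mul h8 h8 (by norm_num) (by linarith)]

/-- Here `B` is `δ ^ 2 * k` or `δ`. The constant `1 / 1280` makes the error probability of a single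
item at least of order `n ^ (-1 / 20) / k`, and `B ≥ n ^ (-1 / 2)` provides an independent set of
size of order `n ^ (2 / 5)`. -/
lemma RandAlg.successProb_le_exp_neg_rpow {n k t : ℕ} {δ B : ℝ} (hn : 0 < n) (hk : 2 ≤ k) (h0 : 0 ≤ δ) (h1 : δ ≤ 1 / 4)
    (hkn : (k : ℝ) ≤ (n : ℝ) ^ (1 / 20 : ℝ)) (hB : (n : ℝ) ^ (-(1 / 2) : ℝ) ≤ B)
    (hhB : noiseHellinger k δ ≤ 4 * B)
    (ht : (t : ℝ) ≤ 1 / 1280 * (n * Real.log n / B))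
    (hlog : 1 ≤ Real.log n)
    (hest : 1 / 100 * Real.log n * (n : ℝ) ^ (1 / 2 : ℝ) + 1 ≤ (n : ℝ) ^ (3 / 5 : ℝ))
    (hfin : 1 / 20 * Real.log n + (n : ℝ) ^ (1 / 10 : ℝ) ≤ (n : ℝ) ^ (3 / 10 : ℝ) / 4)
    (A : RandAlg.{u} n k) (hA : A.MakesAtMost t) :
    A.successProb δ ≤ Real.exp (-((n : ℝ) ^ (1 / 10 : ℝ))) := by
  refine (A.successProb_le hk h0 h1 hA).trans ?_
  have hdiv : ((4 * t / n : ℕ) : ℝ) ≤ 4 * t / n := by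
    have := Nat.cast_div_le (α := ℝ) (m := 4 * t) (n := n)
    push_cast at this
    exact this
  generalize 4 * t / n = Δ at *
  have hx : (0 : ℝ) < n := by exact_mod_cast hn
  have hk0 : (2 : ℝ) ≤ k := by exact_mod_cast hk
  generalize (n : ℝ) = x at *
  have hB0 : 0 < B := lt_of_lt_of_le (by positivity) hB
  have hΔB : Δ * B ≤ 1 / 320 * Real.log x := by
    calc Δ * B ≤ 4 * t / x * B := by gcongr
      _ ≤ 4 * (1 / 1280 * (x * Real.log x / B)) / x * B := by gcongr
      _ = _ := by field_simp; norm_num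
  have hΔ : (Δ : ℝ) + 1 ≤ x ^ (3 / 5 : ℝ) := by
    refine le_trans ?_ hest
    have hxx : x ^ (-(1 / 2) : ℝ) * x ^ (1 / 2 : ℝ) = 1 := by
      rw [← Real.rpow_add hx]; norm_num
    have : (Δ : ℝ) ≤ 1 / 320 * Real.log x * x ^ (1 / 2 : ℝ) := by
      calc (Δ : ℝ) = Δ * x ^ (-(1 / 2) : ℝ) * x ^ (1 / 2 : ℝ) := by rw [mul_assoc, hxx, mul_one]
        _ ≤ Δ * B * x ^ (1 / 2 : ℝ) := by gcongr
        _ ≤ _ := by gcongr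
    have h3 : 0 ≤ Real.log x * x ^ (1 / 2 : ℝ) := by positivity
    linarith
  have hh0 : 0 ≤ noiseHellinger k δ := sq_nonneg _
  have hh1 := (noiseHellinger_le hk h0 h1).1
  have hpow : x ^ (-(1 / 20) : ℝ) ≤ (1 - noiseHellinger k δ) ^ (2 * Δ) := by
    calc x ^ (-(1 / 20) : ℝ) = Real.exp (-(1 / 20 * Real.log x)) := by
          rw [Real.rpow_def_of_pos hx]; ring_nf
      _ ≤ Real.exp (((2 * Δ : ℕ) : ℝ) * -(2 * noiseHellinger k δ)) := by
          rw [Real.exp_le_exp]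
          push_cast
          have := mul_le_mul_of_nonneg_left hhB (Nat.cast_nonneg (α := ℝ) Δ)
          linarith
      _ = Real.exp (-(2 * noiseHellinger k δ)) ^ (2 * Δ) := Real.exp_nat_mul _ _
      _ ≤ _ := by
          gcongr
          exact exp_neg_two_mul_le_one_sub hh0 (by linarith)
  have hmain : x ^ (3 / 10 : ℝ) / 4
      ≤ x * (1 - noiseHellinger k δ) ^ (2 * Δ) / (4 * k * (Δ + 1)) := by
    calc x ^ (3 / 10 : ℝ) / 4
        = x * x ^ (-(1 / 20) : ℝ) / (4 * x ^ (1 / 20 : ℝ) * x ^ (3 / 5 : ℝ)) := by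
          rw [div_eq_div_iff (by positivity) (by positivity)]
          have : x ^ (3 / 10 : ℝ) * (x ^ (1 / 20 : ℝ) * x ^ (3 / 5 : ℝ))
              = x * x ^ (-(1 / 20) : ℝ) := by
            rw [← Real.rpow_add hx, ← Real.rpow_add hx, ← Real.rpow_one_add' hx.le (by norm_num)]
            norm_num
          linarith
      _ ≤ _ := by
          have : 0 ≤ x * (1 - noiseHellinger k δ) ^ (2 * Δ) :=
            mul_nonneg hx.le (le_trans (by positivity) hpow)
          gcongr
  calc (k : ℝ) * Real.exp (-(x * (1 - noiseHellinger k δ) ^ (2 * Δ) / (4 * k * (Δ + 1))))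
      ≤ x ^ (1 / 20 : ℝ) * Real.exp (-(x ^ (3 / 10 : ℝ) / 4)) := by gcongr
    _ = Real.exp (1 / 20 * Real.log x - x ^ (3 / 10 : ℝ) / 4) := by
        rw [Real.rpow_def_of_pos hx, ← Real.exp_add]; ring_nf
    _ ≤ _ := by rw [Real.exp_le_exp]; linarith

lemma eventually_successProb_le {k t : ℕ → ℕ} {δ B : ℕ → ℝ} (hk : ∀ᶠ n in atTop, 2 ≤ k n)
    (hkn : ∀ᶠ n : ℕ in atTop, (k n : ℝ) ≤ (n : ℝ) ^ (1 / 20 : ℝ))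
    (hδ : ∀ᶠ n in atTop, 0 ≤ δ n ∧ δ n ≤ 1 / 4)
    (hB : ∀ᶠ n : ℕ in atTop, (n : ℝ) ^ (-(1 / 2) : ℝ) ≤ B n)
    (hhB : ∀ᶠ n in atTop, noiseHellinger (k n) (δ n) ≤ 4 * B n)
    (ht : (fun n => (t n : ℝ)) =o[atTop] fun n : ℕ => (n : ℝ) * Real.log n / B n) :
    ∀ᶠ n : ℕ in atTop, ∀ A : RandAlg.{u} n (k n), A.MakesAtMost (t n) →
      A.successProb (δ n) ≤ Real.exp (-((n : ℝ) ^ (1 / 10 : ℝ))) := by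
  filter_upwards [hk, hkn, hδ, hB, hhB, ht.bound (c := 1 / 1280) (by norm_num),
    eventually_rpow_estimates, eventually_gt_atTop 0]
    with n hk hkn hδ hB hhB ht ⟨hlog, hest, hfin⟩ hn A hA
  have hB0 : 0 ≤ B n := le_trans (by positivity) hB
  rw [Real.norm_of_nonneg (by positivity), Real.norm_of_nonneg (by positivity)] at ht
  exact A.successProb_le_exp_neg_rpow hn hk hδ.1 hδ.2 hkn hB hhB ht hlog hest hfin hA

lemma SubpolynomiallyBounded.eventually_le_rpow {k : ℕ → ℕ} (hk : SubpolynomiallyBounded k)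
    {a : ℝ} (ha : 0 < a) : ∀ᶠ n : ℕ in atTop, (k n : ℝ) ≤ (n : ℝ) ^ a := by
  obtain ⟨e, he, hke⟩ := hk
  filter_upwards [hke, he.eventually_le_const ha, eventually_ge_atTop 1] with n h1 h2 h3
  exact h1.trans (Real.rpow_le_rpow_of_exponent_le (by exact_mod_cast h3) h2)

end JointAlignment

theorem mainTheorem2 :
    ∃ c : ℝ, 0 < c ∧
      (∀ (k t : ℕ → ℕ) (δ : ℕ → ℝ),
        (∀ᶠ n in atTop, 2 ≤ k n) →
        JointAlignment.SubpolynomiallyBounded k →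
        (∀ᶠ n : ℕ in atTop,
          1 / (n : ℝ) ^ ((1 : ℝ) / 4) ≤ δ n ∧ δ n ≤ 1 / (2 * (k n : ℝ))) →
        (fun n => (t n : ℝ)) =o[atTop]
          (fun n : ℕ => (n : ℝ) * Real.log (n : ℝ) / (δ n ^ 2 * (k n : ℝ))) →
        ∀ᶠ n : ℕ in atTop, ∀ A : JointAlignment.RandAlg.{u} n (k n), A.MakesAtMost (t n) →
          A.successProb (δ n) ≤ Real.exp (-((n : ℝ) ^ c))) ∧
      (∀ (k t : ℕ → ℕ) (δ : ℕ → ℝ),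
        (∀ᶠ n in atTop, 2 ≤ k n) →
        JointAlignment.SubpolynomiallyBounded k →
        (∀ᶠ n in atTop, 1 / (2 * (k n : ℝ)) ≤ δ n ∧ δ n ≤ 1 / 4) →
        (fun n => (t n : ℝ)) =o[atTop]
          (fun n : ℕ => (n : ℝ) * Real.log (n : ℝ) / δ n) →
        ∀ᶠ n : ℕ in atTop, ∀ A : JointAlignment.RandAlg.{u} n (k n), A.MakesAtMost (t n) →
          A.successProb (δ n) ≤ Real.exp (-((n : ℝ) ^ c))) := by
  refine ⟨1 / 10, by norm_num, ?_, ?_⟩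
  · intro k t δ hk hsub hδ ht
    have hkn := hsub.eventually_le_rpow (a := 1 / 20) (by norm_num)
    have hδ' : ∀ᶠ n in atTop, 0 ≤ δ n ∧ δ n ≤ 1 / 4 := by
      filter_upwards [hδ, hk] with n h hk
      have hk' : (2 : ℝ) ≤ k n := by exact_mod_cast hk
      refine ⟨le_trans (by positivity) h.1, h.2.trans ?_⟩
      exact one_div_le_one_div_of_le (by norm_num) (by linarith)
    refine JointAlignment.eventually_successProb_le hk hkn hδ' ?_ ?_ ht
    · filter_upwards [hδ, hk, eventually_gt_atTop 0] with n h hk hn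
      have hk' : (2 : ℝ) ≤ k n := by exact_mod_cast hk
      have hx : (0 : ℝ) < n := by exact_mod_cast hn
      calc (n : ℝ) ^ (-(1 / 2) : ℝ) = (1 / (n : ℝ) ^ ((1 : ℝ) / 4)) ^ 2 := by
            rw [one_div (_ ^ _), ← Real.rpow_neg hx.le, ← Real.rpow_natCast, ← Real.rpow_mul hx.le]
            norm_num
        _ ≤ δ n ^ 2 := pow_le_pow_left₀ (by positivity) h.1 2
        _ ≤ δ n ^ 2 * k n := le_mul_of_one_le_right (by positivity) (by linarith)
    · filter_upwards [hδ', hk] with n h hk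
      exact (JointAlignment.noiseHellinger_le hk h.1 h.2).2
  · intro k t δ hk hsub hδ ht
    have hkn := hsub.eventually_le_rpow (a := 1 / 20) (by norm_num)
    have hδ' : ∀ᶠ n in atTop, 0 ≤ δ n ∧ δ n ≤ 1 / 4 := by
      filter_upwards [hδ] with n h
      exact ⟨le_trans (by positivity) h.1, h.2⟩
    refine JointAlignment.eventually_successProb_le hk hkn hδ' ?_ ?_ ht
    · filter_upwards [hδ, hk, hsub.eventually_le_rpow (a := 1 / 4) (by norm_num),
        eventually_gt_atTop 0, (tendsto_natCast_atTop_atTop (R := ℝ)).eventually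
          ((tendsto_rpow_atTop (y := 1 / 4) (by norm_num)).eventually_ge_atTop 2)]
        with n h hk hkn hn h2
      have hk' : (2 : ℝ) ≤ k n := by exact_mod_cast hk
      have hx : (0 : ℝ) < n := by exact_mod_cast hn
      refine le_trans ?_ h.1
      rw [Real.rpow_neg hx.le, ← one_div]
      refine one_div_le_one_div_of_le (by linarith) ?_
      calc 2 * (k n : ℝ) ≤ (n : ℝ) ^ (1 / 4 : ℝ) * (n : ℝ) ^ (1 / 4 : ℝ) := by gcongr
        _ = (n : ℝ) ^ (1 / 2 : ℝ) := by rw [← Real.rpow_add hx]; norm_num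
    · filter_upwards [hδ', hk] with n h hk
      linarith [(JointAlignment.noiseHellinger_le hk h.1 h.2).1, h.1]
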